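/- Let $n\ge 2$, let $\mathbb F$ be a field in which $(n-1)!\neq 0$ (that is, of characteristic $0$ or at least $n$), let $V$ be a vector space over $\mathbb F$ with basis $\hat e_1,\dots,\hat e_n$, put $N=\{1,\dots,n\}$, and let $L$ be a nonempty set of symbols. Each assignment $M$ of linear maps $M_A\colon V\to V$ to the symbols $A\in L$ gives matrices of entries $(M_A)_{ij}$ with respect to this basis. **Definitions.** An *$n$-trace diagram* $\mathcal D$ is a finite multigraph (loops, and trivial loops meeting no vertex, are allowed) whose vertex set is a disjoint union $V_1\sqcup V_2\sqcup V_n$, where the vertices in $V_i$ have degree $i$ (loops count twice), with an ordering $\sigma_v(1),\sigma_v(2),\dots$ of the edges at each vertex $v$, and a symbol $A_v\in L$ (a *matrix marking*) at each $v\in V_2$; there $\sigma_v(1)$ is called the incoming and $\sigma_v(2)$ the outgoing edge. A *proper coloring* is a map $\kappa\colon E\to N$ from the set of edges such that $\pi_\kappa(v)\colon j\mapsto\kappa(\sigma_v(j))$ is a permutation of $N$ for each $v\in V_n$. For an assignment $M$, the *weight* of a labelling $\gamma\colon V_1\to N$ is $$\chi_\gamma(\mathcal D)=\sum_{\kappa}\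 \prod_{v\in V_n}\operatorname{sgn}\pi_\kappa(v)\ \prod_{v\in V_2}(M_{A_v})_{\kappa(\sigma_v(2)),\,\kappa(\sigma_v(1))},$$ the sum being over all proper colorings that give the edge at each $x\in V_1$ the color $\gamma(x)$. A *framing* lists the vertices in $V_1$ as $p$ ordered inputs and $q$ ordered outputs; the framed diagram has the function $f_{\mathcal D}\colon V^{\otimes p}\to V^{\otimes q}$, $\hat e_\alpha\mapsto\sum_{\beta\in N^q}\chi_{\alpha\cup\beta}(\mathcal D)\,\hat e_\beta$. For $A\in L$, a *diagram $A$-minor* consists of one vertex in $V_n$ and $n$ strands leading from it to $n$ distinct vertices of degree 1, where some of the strands (possibly none, possibly all) carry one marking each, all these markings are $A$, and either all of them point away from the $n$-vertex (the incoming edge is the one at the $n$-vertex) or all of them point towards it. A diagram *decomposes into diagram minors* if cutting some of its non-trivial edges (each cut replaces an edge by two edges, one for each of its ends, that lead to two new vertices of degree 1) leaves a disjoint union of finitely many diagram minors (for various $A\in L$). **Theorem.** Let $\mathcal D$ be an $n$-trace diagram in which every matrix marking is adjacent to an $n$-vertex. (1) There are a constant $C\in\mathbb F$, $C\ne0$,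 and an $n$-trace diagram $\mathcal D'$ with the same degree-1 vertices such that $\mathcal D'$ decomposes into diagram minors and, for every assignment $M$ of linear maps to the symbols and every framing, $f_{\mathcal D}=C\,f_{\mathcal D'}$. In particular $C$ and $\mathcal D'$ do not depend on any matrix entries. (2) Each diagram minor evaluates to a signed matrix minor. Namely, let the degree-1 vertices of a diagram $A$-minor be labelled by elements of $N$. If the labels of the marked strands are distinct and the labels of the unmarked strands are distinct, let $I$ be the set of labels of the marked strands and $J$ the complement in $N$ of the set of labels of the unmarked strands. Then $|I|=|J|$, and there is a sign $\varepsilon\in\{1,-1\}$ such that for every assignment $M$ the weight of the labelling is $\varepsilon\,[(M_A)_{I,J}]$ if the markings point away from the $n$-vertex, and $\varepsilon\,[(M_A)_{J,I}]$ if they point towards it, where $[B_{I,J}]$ is the determinant of the submatrix of $B$ with rows $I$ and columns $J$ in increasing order. In all other cases the weight is $0$ for every $M$. -/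

import Mathlib

open scoped TensorProduct

/-- An end of an edge of an `n`-trace diagram, that is, a place in the ordering of the edges at a
vertex: a vertex of degree 1 has one place, a matrix vertex two (`0` incoming, `1` outgoing),
an `n`-vertex has `n`. -/
inductive EdgeEnd (n : ℕ) (V₁ V₂ Vn : Type) : Type
  | leaf (x : V₁)
  | mark (v : V₂) (i : Fin 2)
  | node (v : Vn) (j : Fin n)

/-- Relabelling of edge ends along maps of the three kinds of vertices. -/
def EdgeEnd.map {n : ℕ} {V₁ V₂ Vn W₁ W₂ Wn : Type} (f : V₁ → W₁) (g : V₂ → W₂) (h : Vn → Wn) :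
    EdgeEnd n V₁ V₂ Vn → EdgeEnd n W₁ W₂ Wn
  | .leaf x => .leaf (f x)
  | .mark v i => .mark (g v) i
  | .node v j => .node (h v) j

/-- The sum decomposition of edge ends. -/
def EdgeEnd.equivSum (n : ℕ) (V₁ V₂ Vn : Type) :
    EdgeEnd n V₁ V₂ Vn ≃ V₁ ⊕ (V₂ × Fin 2) ⊕ (Vn × Fin n) where
  toFun
    | .leaf x => .inl x
    | .mark v i => .inr (.inl (v, i))
    | .node v j => .inr (.inr (v, j))
  invFun
    | .inl x => .leaf x
    | .inr (.inl (v, i)) => .mark v i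
    | .inr (.inr (v, j)) => .node v j
  left_inv := by rintro (_ | _ | _) <;> rfl
  right_inv := by rintro (_ | ⟨_, _⟩ | ⟨_, _⟩) <;> rfl

instance EdgeEnd.finite {n : ℕ} {V₁ V₂ Vn : Type} [Finite V₁] [Finite V₂] [Finite Vn] :
    Finite (EdgeEnd n V₁ V₂ Vn) :=
  Finite.of_equiv _ (EdgeEnd.equivSum n V₁ V₂ Vn).symm

theorem EdgeEnd.map_injective {n : ℕ} {V₁ V₂ Vn W₁ W₂ Wn : Type} {f : V₁ → W₁} {g : V₂ → W₂}
    {h : Vn → Wn} (hf : f.Injective) (hg : g.Injective) (hh : h.Injective) :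
    (EdgeEnd.map (n := n) f g h).Injective := by
  rintro (_ | _ | _) (_ | _ | _) <;> simp [EdgeEnd.map, hf.eq_iff, hg.eq_iff, hh.eq_iff]

/-- An (unframed) `n`-trace diagram whose degree-1 vertices are the elements of `V₁` and whose
matrix vertices carry symbols from `L`; the linear maps that the symbols stand for are supplied
when the diagram is evaluated. For a vertex `v` the map `i ↦ edge (mark v i)`, respectively
`j ↦ edge (node v j)`, is the ordering (ciliation) of the edges at `v`. An edge has two ends
(two distinct vertices, or a loop at one vertex), or none: a trivial loop. -/
structure TraceDiagram (n : ℕ) (L : Type*) (V₁ : Type) where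
  /-- vertices of degree 2, which carry the matrix markings -/
  V₂ : Type
  /-- vertices of degree `n` -/
  Vn : Type
  /-- edges -/
  E : Type
  [fintypeV₂ : Fintype V₂]
  [fintypeVn : Fintype Vn]
  [fintypeE : Fintype E]
  /-- the edge to which an end belongs -/
  edge : EdgeEnd n V₁ V₂ Vn → E
  /-- the matrix markings -/
  label : V₂ → L
  ends_eq : ∀ e : E, {s | edge s = e}.encard = 0 ∨ {s | edge s = e}.encard = 2

namespace TraceDiagram

attribute [instance] fintypeV₂ fintypeVn fintypeE

section Evaluation

variable {n : ℕ} {L : Type*} {V₁ : Type} (D : TraceDiagram n L V₁)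

/-- A coloring is proper if the labels at each `n`-vertex are distinct. -/
def IsProper (κ : D.E → Fin n) : Prop :=
  ∀ v : D.Vn, Function.Injective fun j => κ (D.edge (.node v j))

/-- The permutation `j ↦ κ (σ_v j)` that a proper coloring induces at an `n`-vertex. -/
noncomputable def perm (κ : D.E → Fin n) (hκ : D.IsProper κ) (v : D.Vn) : Equiv.Perm (Fin n) :=
  Equiv.ofBijective (fun j => κ (D.edge (.node v j))) (Finite.injective_iff_bijective.1 (hκ v))

/-- The signature of a proper coloring. -/
noncomputable def signature (κ : D.E → Fin n) (hκ : D.IsProper κ) : ℤˣ :=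
  ∏ v : D.Vn, Equiv.Perm.sign (D.perm κ hκ v)

/-- The coefficient of a coloring: for each marking, the matrix entry in the row given by the
outgoing edge and the column given by the incoming edge. -/
noncomputable def coeff {F V : Type*} [Field F] [AddCommGroup V] [Module F V]
    (b : Module.Basis (Fin n) F V) (M : L → V →ₗ[F] V) (κ : D.E → Fin n) : F :=
  ∏ v : D.V₂, LinearMap.toMatrix b b (M (D.label v))
    (κ (D.edge (.mark v 1))) (κ (D.edge (.mark v 0)))

open Classical in
/-- The weight of a labelling `γ` of the leaves: the sum of signature times coefficient over all
proper colorings that extend it (an empty sum if two leaves on one edge have different labels). -/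
noncomputable def weight {F V : Type*} [Field F] [AddCommGroup V] [Module F V]
    (b : Module.Basis (Fin n) F V) (M : L → V →ₗ[F] V) (γ : V₁ → Fin n) : F :=
  ∑ κ : {κ : D.E → Fin n // D.IsProper κ ∧ ∀ x, κ (D.edge (.leaf x)) = γ x},
    (((D.signature κ.1 κ.2.1 : ℤˣ) : ℤ) : F) * D.coeff b M κ.1

/-- The trace diagram function `V^{⊗p} → V^{⊗q}` of a diagram with the framing `φ`, which lists the
degree-1 vertices as `p` ordered inputs and `q` ordered outputs. -/
noncomputable def function {F V : Type*} [Field F] [AddCommGroup V] [Module F V]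
    (b : Module.Basis (Fin n) F V) (M : L → V →ₗ[F] V) {p q : ℕ} (φ : Fin p ⊕ Fin q ≃ V₁) :
    (⨂[F] _ : Fin p, V) →ₗ[F] (⨂[F] _ : Fin q, V) :=
  (Basis.piTensorProduct fun _ : Fin p => b).constr F fun α =>
    ∑ β : Fin q → Fin n, D.weight b M (Sum.elim α β ∘ φ.symm) • ⨂ₜ[F] j, b (β j)

/-- Every matrix marking is adjacent to an `n`-vertex. -/
def MarkingsAdjacentToNodes : Prop :=
  ∀ v : D.V₂, ∃ (i : Fin 2) (w : D.Vn) (j : Fin n), D.edge (.mark v i) = D.edge (.node w j)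

end Evaluation

section Decomposition

variable {n : ℕ} {L : Type*}

/-- An isomorphism of (unframed) trace diagrams, preserving orderings at vertices and markings. -/
structure Iso {V₁ W₁ : Type} (D : TraceDiagram n L V₁) (D' : TraceDiagram n L W₁) where
  onV₁ : V₁ ≃ W₁
  onV₂ : D.V₂ ≃ D'.V₂
  onVn : D.Vn ≃ D'.Vn
  onE : D.E ≃ D'.E
  edge_map : ∀ s, D'.edge (s.map onV₁ onV₂ onVn) = onE (D.edge s)
  label_map : ∀ v, D'.label (onV₂ v) = D.label v

/-- The ends of the edges in `S`. -/
abbrev CutEnd {V₁ : Type} (D : TraceDiagram n L V₁) (S : Set D.E) : Type :=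
  {s : EdgeEnd n V₁ D.V₂ D.Vn // D.edge s ∈ S}

/-- The edge of the cut diagram that contains the end `s` of the original diagram. -/
noncomputable def cutEdge {V₁ : Type} (D : TraceDiagram n L V₁) (S : Set D.E)
    (s : EdgeEnd n V₁ D.V₂ D.Vn) : {e : D.E // e ∉ S} ⊕ D.CutEnd S :=
  open Classical in if h : D.edge s ∈ S then .inr ⟨s, h⟩ else .inl ⟨D.edge s, h⟩

/-- The diagram obtained by cutting the edges in `S`: such an edge is replaced by two edges, one
for each of its ends, which lead to two new vertices of degree 1. -/
noncomputable def cut {V₁ : Type} [Finite V₁] (D : TraceDiagram n L V₁) (S : Set D.E) :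
    TraceDiagram n L (V₁ ⊕ D.CutEnd S) where
  V₂ := D.V₂
  Vn := D.Vn
  E := {e : D.E // e ∉ S} ⊕ D.CutEnd S
  fintypeE := Fintype.ofFinite _
  edge
    | .leaf (.inl x) => D.cutEdge S (.leaf x)
    | .leaf (.inr s) => .inr s
    | .mark v i => D.cutEdge S (.mark v i)
    | .node v j => D.cutEdge S (.node v j)
  label := D.label
  ends_eq := by
    have key : ∀ s : EdgeEnd n V₁ D.V₂ D.Vn, ∀ f : EdgeEnd n (V₁ ⊕ D.CutEnd S) D.V₂ D.Vn →
        {e : D.E // e ∉ S} ⊕ D.CutEnd S, f = (fun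
          | .leaf (.inl x) => D.cutEdge S (.leaf x)
          | .leaf (.inr s) => .inr s
          | .mark v i => D.cutEdge S (.mark v i)
          | .node v j => D.cutEdge S (.node v j)) → f (s.map Sum.inl id id) = D.cutEdge S s := by
      rintro (_ | _ | _) f rfl <;> rfl
    have hinj := EdgeEnd.map_injective (n := n) (Sum.inl_injective (α := V₁) (β := D.CutEnd S))
      (Function.injective_id (α := D.V₂)) (Function.injective_id (α := D.Vn))
    have hcov : ∀ s' : EdgeEnd n (V₁ ⊕ D.CutEnd S) D.V₂ D.Vn,
        (∃ s, s' = .leaf (.inr s)) ∨ ∃ s : EdgeEnd n V₁ D.V₂ D.Vn, s' = s.map Sum.inl id id := by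
      rintro ((x | s) | ⟨v, i⟩ | ⟨v, j⟩)
      · exact .inr ⟨.leaf x, rfl⟩
      · exact .inl ⟨s, rfl⟩
      · exact .inr ⟨.mark v i, rfl⟩
      · exact .inr ⟨.node v j, rfl⟩
    rintro (⟨e, he⟩ | s)
    · convert D.ends_eq e using 2 <;>
      · rw [← hinj.encard_image {s | D.edge s = e}]
        congr 1
        ext s'
        obtain ⟨s, rfl⟩ | ⟨s, rfl⟩ := hcov s'
        · simp only [Set.mem_ofPred_eq, Set.mem_image, reduceCtorEq, false_iff]
          rintro ⟨t, -, ht⟩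
          cases t <;> simp [EdgeEnd.map] at ht
        · rw [hinj.mem_set_image, Set.mem_ofPred_eq, key s _ rfl, Set.mem_ofPred_eq, cutEdge]
          split_ifs with h
          · simp only [false_iff]
            rintro rfl
            exact he h
          · simp
    · right
      have hne : (.leaf (.inr s) : EdgeEnd n (V₁ ⊕ D.CutEnd S) D.V₂ D.Vn) ≠
          s.1.map Sum.inl id id := by
        cases s.1 <;> simp [EdgeEnd.map]
      rw [← Set.encard_pair hne]
      congr 1
      ext s'
      obtain ⟨t, rfl⟩ | ⟨t, rfl⟩ := hcov s'
      · have : (.leaf (.inr t) : EdgeEnd n (V₁ ⊕ D.CutEnd S) D.V₂ D.Vn) ≠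
            s.1.map Sum.inl id id := by
          cases s.1 <;> simp [EdgeEnd.map]
        simp [this]
      · have : t.map Sum.inl id id ≠
            (.leaf (.inr s) : EdgeEnd n (V₁ ⊕ D.CutEnd S) D.V₂ D.Vn) := by
          cases t <;> simp [EdgeEnd.map]
        rw [Set.mem_ofPred_eq, key t _ rfl, cutEdge]
        simp only [Set.mem_insert_iff, this, Set.mem_singleton_iff, false_or, hinj.eq_iff]
        split_ifs with h
        · simp [Subtype.ext_iff]
        · simp only [false_iff]
          rintro rfl
          exact h s.2

/-- The disjoint union of a finite family of diagrams. -/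
def disjointUnion {K : Type} [Fintype K] {W : K → Type} (P : ∀ k, TraceDiagram n L (W k)) :
    TraceDiagram n L (Σ k, W k) where
  V₂ := Σ k, (P k).V₂
  Vn := Σ k, (P k).Vn
  E := Σ k, (P k).E
  edge
    | .leaf ⟨k, x⟩ => ⟨k, (P k).edge (.leaf x)⟩
    | .mark ⟨k, v⟩ i => ⟨k, (P k).edge (.mark v i)⟩
    | .node ⟨k, v⟩ j => ⟨k, (P k).edge (.node v j)⟩
  label v := (P v.1).label v.2
  ends_eq := by
    rintro ⟨k, e⟩
    have hinj := EdgeEnd.map_injective (n := n) (sigma_mk_injective (β := W) (i := k))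
      (sigma_mk_injective (β := fun k => (P k).V₂) (i := k))
      (sigma_mk_injective (β := fun k => (P k).Vn) (i := k))
    convert (P k).ends_eq e using 2 <;>
    · rw [← hinj.encard_image {s | (P k).edge s = e}]
      congr 1
      ext s'
      simp only [Set.mem_ofPred_eq, Set.mem_image]
      constructor
      · intro h
        rcases s' with ⟨l, x⟩ | ⟨⟨l, v⟩, i⟩ | ⟨⟨l, v⟩, j⟩ <;>
        · obtain ⟨rfl, h⟩ := Sigma.mk.inj_iff.1 h
          first
          | exact ⟨.leaf x, eq_of_heq h, rfl⟩
          | exact ⟨.mark v i, eq_of_heq h, rfl⟩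
          | exact ⟨.node v j, eq_of_heq h, rfl⟩
      · rintro ⟨x | ⟨v, i⟩ | ⟨v, j⟩, rfl, rfl⟩ <;> rfl

/-- The diagram `A`-minor with one `n`-vertex and `n` strands leading from it to the vertices of
degree 1, in which exactly the strands in `T` carry a marking, and each of these is `A`. All
markings have the same orientation: for `o = 0` their incoming edges are at the `n`-vertex
(they point away from it), for `o = 1` their outgoing edges are (they point towards it). -/
def diagramMinor (A : L) (T : Finset (Fin n)) (o : Fin 2) : TraceDiagram n L (Fin n) where
  V₂ := {j // j ∈ T}
  Vn := Unit
  E := Fin n ⊕ {j // j ∈ T}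
  edge
    | .leaf j => if h : j ∈ T then .inr ⟨j, h⟩ else .inl j
    | .mark t i => if i = o then .inl t.1 else .inr t
    | .node _ j => .inl j
  label _ := A
  ends_eq := by
    have h2 : ∀ i : Fin 2, i ≠ o ↔ i = 1 - o := by decide +revert
    rintro (j | t)
    · right
      by_cases hj : j ∈ T
      · rw [← Set.encard_pair (show (.mark ⟨j, hj⟩ o : EdgeEnd n (Fin n) {j // j ∈ T} Unit) ≠
          .node () j by simp)]
        congr 1
        ext (x | ⟨v, i⟩ | ⟨v, i⟩)
        · by_cases hx : x ∈ T
          · simp [hx]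
          · have : x ≠ j := fun h => hx (h ▸ hj)
            simp [hx, this]
        · by_cases hi : i = o <;> simp [hi, Subtype.ext_iff]
        · simp
      · rw [← Set.encard_pair (show (.leaf j : EdgeEnd n (Fin n) {j // j ∈ T} Unit) ≠
          .node () j by simp)]
        congr 1
        ext (x | ⟨v, i⟩ | ⟨v, i⟩)
        · by_cases hx : x ∈ T
          · have : x ≠ j := fun h => hj (h ▸ hx)
            simp [hx, this]
          · simp [hx]
        · have : v.1 ≠ j := fun h => hj (h ▸ v.2)
          by_cases hi : i = o <;> simp [hi, this]
        · simp
    · right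
      rw [← Set.encard_pair (show (.leaf t.1 : EdgeEnd n (Fin n) {j // j ∈ T} Unit) ≠
        .mark t (1 - o) by simp)]
      congr 1
      ext (x | ⟨v, i⟩ | ⟨v, i⟩)
      · by_cases hx : x ∈ T
        · simp [hx, Subtype.ext_iff]
        · have : x ≠ t.1 := fun h => hx (h ▸ t.2)
          simp [hx, this]
      · by_cases hi : i = o
        · have : i ≠ 1 - o := fun h => (h2 i).2 h hi
          subst hi
          simp [this]
        · have ho : i = 1 - o := (h2 i).1 hi
          have ho' : 1 - o ≠ o := ho ▸ hi
          simp [ho, ho']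
      · simp

/-- A diagram decomposes into diagram minors if some of its edges can be cut so that the result is
a disjoint union of diagram minors. -/
def DecomposesIntoMinors {V₁ : Type} [Finite V₁] (D : TraceDiagram n L V₁) : Prop :=
  ∃ S : Set D.E, (∀ e ∈ S, ∃ s, D.edge s = e) ∧
    ∃ (K : Type) (_ : Fintype K) (A : K → L) (T : K → Finset (Fin n)) (o : K → Fin 2),
      Nonempty ((D.cut S).Iso (disjointUnion fun k => diagramMinor (A k) (T k) (o k)))

end Decomposition

end TraceDiagram

/-- The minor `[A_{I,J}]`: the determinant of the submatrix formed from the rows in `I` and the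
columns in `J`, both in increasing order. -/
def matrixMinor {F : Type*} [Field F] {n : ℕ} (A : Matrix (Fin n) (Fin n) F)
    (I J : Finset (Fin n)) (h : I.card = J.card) : F :=
  (A.submatrix (I.orderEmbOfFin rfl) (J.orderEmbOfFin h.symm)).det

/-!
If two `n`-vertices are joined by `n - 1` parallel edges, then in a proper coloring the remaining
edges at the two vertices have the same color, since a permutation of `N` is determined by its
values at `n - 1` places. So inserting into an edge two such `n`-vertices, with the same ordering of
the edges, changes neither the signature (the two signs are equal) nor the coefficient of a
coloring, and multiplies the number of proper colorings by `(n - 1)!`, the number of ways to color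
the parallel edges (`TraceDiagram.weight_thicken`). Here `(n - 1)! ≠ 0` in `F`, so doing this on every edge
gives a diagram with the same function up to a nonzero constant.

In this thickened diagram no edge joins two vertices of degree 1, there are no trivial loops, and
the incoming edge of each marking leads to a new `n`-vertex that carries no other marking. Cutting
all edges other than these and those at the vertices of degree 1 leaves one diagram minor for each
`n`-vertex. This is an instance of the criterion `TraceDiagram.decomposesIntoMinors_of_pos`, which
allows any number of markings at an `n`-vertex as long as their symbols and orientations agree.

For the value of a diagram minor, a proper coloring that extends a labelling `γ` is a permutation
that agrees with `γ` on the unmarked strands. The weight is therefore the Leibniz expansion of the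
determinant of a matrix (`rowSelection`) with rows of `M_A`, or of its transpose, at the marked
strands and unit vectors at the unmarked ones (`TraceDiagram.weight_diagramMinor`). If `γ` repeats
a label on marked, or on unmarked, strands, two rows of it agree; otherwise sorting its rows and
columns makes it block triangular, with the required minor and an identity matrix on the diagonal
(`exists_det_rowSelection_eq`).
-/

/-! ### Signed minors as determinants -/

section Minors

variable {F : Type*} [Field F] {n : ℕ}

/-- The matrix whose row `j` is row `γ j` of `B` if `j ∈ T`, and the unit vector at `γ j`
otherwise. Its determinant is the weight of a diagram minor. -/
def rowSelection (B : Matrix (Fin n) (Fin n) F) (T : Finset (Fin n)) (γ : Fin n → Fin n) :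
    Matrix (Fin n) (Fin n) F :=
  Matrix.of fun j i => if j ∈ T then B (γ j) i else if i = γ j then 1 else 0

theorem det_rowSelection_eq_zero (B : Matrix (Fin n) (Fin n) F) {T : Finset (Fin n)}
    {γ : Fin n → Fin n}
    (h : ¬ (Set.InjOn γ T ∧ Set.InjOn γ (Tᶜ : Finset (Fin n)))) :
    (rowSelection B T γ).det = 0 := by
  have key : ∃ i j, i ≠ j ∧ (i ∈ T ↔ j ∈ T) ∧ γ i = γ j := by
    by_contra! hc
    refine h ⟨fun i hi j hj hij => ?_, fun i hi j hj hij => ?_⟩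
    · by_contra hne
      exact hc i j hne (iff_of_true hi hj) hij
    · by_contra hne
      rw [Finset.mem_coe, Finset.mem_compl] at hi hj
      exact hc i j hne (iff_of_false hi hj) hij
  obtain ⟨i, j, hij, hT, hγ⟩ := key
  refine Matrix.det_zero_of_row_eq hij ?_
  ext k
  simp [rowSelection, hT, hγ]

theorem card_image_eq_card_compl_image {T : Finset (Fin n)} {γ : Fin n → Fin n}
    (h₁ : Set.InjOn γ T) (h₂ : Set.InjOn γ (Tᶜ : Finset (Fin n))) :
    (T.image γ).card = (Tᶜ.image γ)ᶜ.card := by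
  have := T.card_le_univ
  rw [Finset.card_image_of_injOn h₁, Finset.card_compl, Finset.card_image_of_injOn h₂,
    Finset.card_compl]
  simp only [Fintype.card_fin] at *
  omega

theorem matrixMinor_transpose (B : Matrix (Fin n) (Fin n) F) (I J : Finset (Fin n))
    (h : I.card = J.card) : matrixMinor B.transpose I J h = matrixMinor B J I h.symm := by
  have gen : ∀ (k l : ℕ) (hkl : k = l) (hI : I.card = k) (hJ : J.card = k) (hI' : I.card = l)
      (hJ' : J.card = l),
      (B.transpose.submatrix (I.orderEmbOfFin hI) (J.orderEmbOfFin hJ)).det =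
        (B.submatrix (J.orderEmbOfFin hJ') (I.orderEmbOfFin hI')).det := by
    rintro k _ rfl hI hJ _ _
    rw [← Matrix.det_transpose, Matrix.transpose_submatrix, Matrix.transpose_transpose]
  exact gen _ _ h rfl h.symm h rfl

/-- After a permutation of the columns the matrix is block triangular, with a minor of `B` and an
identity matrix on the diagonal; the sign depends only on `T` and `γ`. -/
theorem exists_det_rowSelection_eq {T : Finset (Fin n)} {γ : Fin n → Fin n}
    (h₁ : Set.InjOn γ T) (h₂ : Set.InjOn γ (Tᶜ : Finset (Fin n)))
    (h : (T.image γ).card = (Tᶜ.image γ)ᶜ.card) :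
    ∃ ε : ℤˣ, ∀ B : Matrix (Fin n) (Fin n) F, (rowSelection B T γ).det =
      ((ε : ℤ) : F) * matrixMinor B (T.image γ) (Tᶜ.image γ)ᶜ h := by
  classical
  set I := T.image γ with hI
  set J := (Tᶜ.image γ)ᶜ with hJ
  -- rows: the elements of `T` in the order of their labels, then the complement of `T`
  have hpre : ∀ i : Fin I.card, ∃ t ∈ T, γ t = I.orderEmbOfFin rfl i := fun i =>
    Finset.mem_image.1 (I.orderEmbOfFin_mem rfl i)
  choose r hrT hr using hpre
  let rows : Fin I.card ⊕ {j // j ∉ T} → Fin n := Sum.elim r Subtype.val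
  -- columns: `J` in increasing order, then the labels of the complement of `T`
  let cols : Fin I.card ⊕ {j // j ∉ T} → Fin n :=
    Sum.elim (J.orderEmbOfFin h.symm) fun j => γ j
  have hJmem : ∀ i, ∀ j ∉ T, J.orderEmbOfFin h.symm i ≠ γ j := by
    intro i j hj hij
    have := J.orderEmbOfFin_mem h.symm i
    rw [hij, hJ, Finset.mem_compl] at this
    exact this (Finset.mem_image_of_mem _ (Finset.mem_compl.2 hj))
  have hcard : Fintype.card (Fin I.card ⊕ {j // j ∉ T}) = Fintype.card (Fin n) := by
    have := T.card_le_univ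
    rw [Fintype.card_sum, Fintype.card_fin, hI, Finset.card_image_of_injOn h₁,
      Fintype.card_subtype_compl, Fintype.card_coe]
    omega
  have hrows : rows.Bijective := by
    refine (Fintype.bijective_iff_injective_and_card _).2 ⟨?_, hcard⟩
    refine Function.Injective.sumElim (fun i j hij => ?_) Subtype.val_injective ?_
    · apply (I.orderEmbOfFin rfl).injective
      rw [← hr, ← hr, hij]
    · intro i j hij
      exact j.2 (hij ▸ hrT i)
  have hcols : cols.Bijective := by
    refine (Fintype.bijective_iff_injective_and_card _).2 ⟨?_, hcard⟩
    refine Function.Injective.sumElim (J.orderEmbOfFin h.symm).injective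
      (fun i j hij => ?_) fun i j => hJmem i j j.2
    exact Subtype.ext (h₂ (by simp) (by simp) hij)
  let er := Equiv.ofBijective rows hrows
  let ec := Equiv.ofBijective cols hcols
  refine ⟨Equiv.Perm.sign (er.symm.trans ec), fun B => ?_⟩
  have hblock : (rowSelection B T γ).submatrix er ec = Matrix.fromBlocks
      (B.submatrix (I.orderEmbOfFin rfl) (J.orderEmbOfFin h.symm))
      (B.submatrix (I.orderEmbOfFin rfl) fun j : {j // j ∉ T} => γ j) 0 1 := by
    ext (i | i) (j | j)
    · simp [rowSelection, er, ec, rows, cols, hrT, hr]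
    · simp [rowSelection, er, ec, rows, cols, hrT, hr]
    · simp [rowSelection, er, ec, rows, cols, i.2, hJmem j i i.2]
    · have : γ j = γ i ↔ i = j := ⟨fun hij => Subtype.ext
        (h₂ (by simp) (by simp) hij.symm), fun hij => hij ▸ rfl⟩
      simp [rowSelection, er, ec, rows, cols, i.2, this, Matrix.one_apply]
  have hperm : (rowSelection B T γ).submatrix er ec =
      ((rowSelection B T γ).submatrix id (er.symm.trans ec)).submatrix er er := by
    ext i j
    simp
  have hdet := congrArg Matrix.det hperm
  rw [hblock, Matrix.det_fromBlocks_zero₂₁, Matrix.det_one, mul_one,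
    Matrix.det_submatrix_equiv_self, Matrix.det_permute'] at hdet
  rw [matrixMinor, hdet, ← mul_assoc, ← Int.cast_mul, ← Units.val_mul, Int.units_mul_self]
  simp

end Minors

namespace TraceDiagram

/-- A proper coloring of a diagram minor extending `γ` is a permutation that agrees with `γ` on the
unmarked strands, so the weight is a Leibniz expansion. -/
theorem weight_diagramMinor {F V L : Type*} [Field F] [AddCommGroup V] [Module F V] {n : ℕ}
    (b : Module.Basis (Fin n) F V) (M : L → V →ₗ[F] V) (A : L) (T : Finset (Fin n)) (o : Fin 2)
    (γ : Fin n → Fin n) :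
    (diagramMinor A T o).weight b M γ = (rowSelection (if o = 0 then
      LinearMap.toMatrix b b (M A) else (LinearMap.toMatrix b b (M A)).transpose) T γ).det := by
  classical
  rw [← Matrix.det_transpose, Matrix.det_apply, weight]
  refine @Fintype.sum_of_injective _ _ _ (_) (_) (_)
    (fun κ => (diagramMinor A T o).perm κ.1 κ.2.1 ()) ?_ _ _ ?_ ?_
  · rintro ⟨κ, hκ⟩ ⟨κ', hκ'⟩ h
    ext1
    funext e
    rcases e with j | t
    · exact DFunLike.congr_fun h j
    · have h1 := hκ.2 t.1
      have h2 := hκ'.2 t.1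
      simp only [diagramMinor, t.2, dite_true] at h1 h2
      exact h1.trans h2.symm
  · intro σ hσ
    have : ∃ j ∉ T, σ j ≠ γ j := by
      by_contra! hc
      refine hσ ⟨⟨Sum.elim σ fun t => γ t, fun _ => σ.injective, fun j => ?_⟩, ?_⟩
      · by_cases hj : j ∈ T
        · simp [diagramMinor, hj]
        · simp [diagramMinor, hj, hc j hj]
      · ext j
        rfl
    obtain ⟨j, hj, hne⟩ := this
    rw [Finset.prod_eq_zero (Finset.mem_univ j), smul_zero]
    simp [rowSelection, hj, hne]
  · rintro ⟨κ, hκ, hγ⟩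
    have hsign : (diagramMinor A T o).signature κ hκ =
        Equiv.Perm.sign ((diagramMinor A T o).perm κ hκ ()) :=
      Fintype.prod_unique (ι := Unit) _
    have hin : ∀ t : {j // j ∈ T}, κ (.inr t) = γ t := fun t => by
      have := hγ t.1
      simpa only [diagramMinor, t.2, dite_true] using this
    have hout : ∀ j ∉ T, κ (.inl j) = γ j := fun j hj => by
      have := hγ j
      simpa only [diagramMinor, hj, dite_false] using this
    have hcoeff : (diagramMinor A T o).coeff b M κ =
        ∏ j, (rowSelection (if o = 0 then LinearMap.toMatrix b b (M A) else
          (LinearMap.toMatrix b b (M A)).transpose) T γ) j (κ (.inl j)) := by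
      rw [← Finset.prod_mul_prod_compl T, Finset.prod_eq_one (s := Tᶜ), mul_one,
        ← Finset.prod_coe_sort]
      · refine Finset.prod_congr rfl fun (t : {j // j ∈ T}) _ => ?_
        obtain rfl | rfl : o = 0 ∨ o = 1 := by omega
        · change LinearMap.toMatrix b b (M A) (κ (.inr t)) (κ (.inl t.1)) = _
          rw [hin]
          simp [rowSelection]
        · change LinearMap.toMatrix b b (M A) (κ (.inl t.1)) (κ (.inr t)) = _
          rw [hin]
          simp [rowSelection]
      · intro j hj
        rw [Finset.mem_compl] at hj
        simp [rowSelection, hj, hout]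
    simp only [hsign, hcoeff, Units.smul_def, zsmul_eq_mul]
    rfl

/-! ### Ends of edges -/

section Ends

variable {n : ℕ} {L : Type*} {V₁ : Type} (D : TraceDiagram n L V₁)

theorem ends_eq_pair (s : EdgeEnd n V₁ D.V₂ D.Vn) :
    ∃ t, t ≠ s ∧ ∀ u, D.edge u = D.edge s ↔ u = s ∨ u = t := by
  rcases D.ends_eq (D.edge s) with h | h
  · rw [Set.encard_eq_zero] at h
    have : s ∈ {u | D.edge u = D.edge s} := rfl
    rw [h] at this
    exact this.elim
  · obtain ⟨x, y, hxy, h⟩ := Set.encard_eq_two.1 h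
    have key : ∀ u, D.edge u = D.edge s ↔ u = x ∨ u = y := fun u => by
      simpa using Set.ext_iff.1 h u
    rcases (key s).1 rfl with rfl | rfl
    · exact ⟨y, hxy.symm, key⟩
    · exact ⟨x, hxy, fun u => (key u).trans or_comm⟩

variable {D}

theorem eq_of_edge_eq {s t u : EdgeEnd n V₁ D.V₂ D.Vn} (hs : D.edge s = D.edge u)
    (ht : D.edge t = D.edge u) (hsu : s ≠ u) (htu : t ≠ u) : s = t := by
  obtain ⟨x, -, hx⟩ := D.ends_eq_pair u
  rw [((hx s).1 hs).resolve_left hsu, ((hx t).1 ht).resolve_left htu]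

/-- Twice the number of edges is the number of ends. -/
theorem card_end_eq [Finite V₁] (h : Function.Surjective D.edge) :
    Nat.card (EdgeEnd n V₁ D.V₂ D.Vn) = Nat.card D.E * 2 := by
  classical
  have := Fintype.ofFinite (EdgeEnd n V₁ D.V₂ D.Vn)
  rw [Nat.card_eq_fintype_card, Nat.card_eq_fintype_card, ← Finset.card_univ,
    Finset.card_eq_sum_card_fiberwise (f := D.edge) (t := Finset.univ) (fun _ _ => by simp),
    Finset.sum_const_nat (m := 2) fun e _ => ?_, Finset.card_univ]
  obtain ⟨s, rfl⟩ := h e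
  obtain ⟨t, hne, ht⟩ := D.ends_eq_pair s
  have : ({u | D.edge u = D.edge s} : Finset _) = {s, t} := by
    ext u
    simp [ht]
  rw [this, Finset.card_pair hne.symm]

end Ends

/-- The equivalence of edge ends induced by equivalences of the three kinds of vertices. -/
def endEquiv {n : ℕ} {V₁ V₂ Vn W₁ W₂ Wn : Type} (f : V₁ ≃ W₁) (g : V₂ ≃ W₂) (h : Vn ≃ Wn) :
    EdgeEnd n V₁ V₂ Vn ≃ EdgeEnd n W₁ W₂ Wn where
  toFun := EdgeEnd.map f g h
  invFun := EdgeEnd.map f.symm g.symm h.symm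
  left_inv := by rintro (_ | _ | _) <;> simp [EdgeEnd.map]
  right_inv := by rintro (_ | _ | _) <;> simp [EdgeEnd.map]

/-- Between diagrams without trivial loops, a compatible map of edges in one direction suffices for
an isomorphism: it is surjective, and both diagrams have half as many edges as ends. -/
theorem nonempty_iso_of_edgeMap {n : ℕ} {L : Type*} {V₁ W₁ : Type} [Finite V₁]
    {D : TraceDiagram n L V₁} {D' : TraceDiagram n L W₁} (hD : Function.Surjective D.edge)
    (hD' : Function.Surjective D'.edge) (f : V₁ ≃ W₁) (g : D.V₂ ≃ D'.V₂) (h : D.Vn ≃ D'.Vn)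
    (hlabel : ∀ v, D'.label (g v) = D.label v) (k : D'.E → D.E)
    (hk : ∀ s, k (D'.edge (s.map f g h)) = D.edge s) : Nonempty (D.Iso D') := by
  have : Finite W₁ := Finite.of_equiv _ f
  have hsurj : Function.Surjective k := fun e => by
    obtain ⟨s, rfl⟩ := hD e
    exact ⟨_, hk s⟩
  have hcard : Nat.card D'.E = Nat.card D.E := by
    have := Nat.card_congr (endEquiv (n := n) f g h)
    rw [card_end_eq hD, card_end_eq hD'] at this
    omega
  have hbij : Function.Bijective k :=
    (Fintype.bijective_iff_surjective_and_card k).2 ⟨hsurj, by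
      rwa [Nat.card_eq_fintype_card, Nat.card_eq_fintype_card] at hcard⟩
  let K := Equiv.ofBijective k hbij
  exact ⟨⟨f, g, h, K.symm, fun s => (Equiv.eq_symm_apply K).2 (hk s), hlabel⟩⟩

/-! ### A criterion for decomposing into diagram minors -/

section Criterion

variable {n : ℕ} {L : Type*} {V₁ : Type}

theorem cutEdge_of_mem {D : TraceDiagram n L V₁} {S : Set D.E} {s : EdgeEnd n V₁ D.V₂ D.Vn}
    (h : D.edge s ∈ S) : D.cutEdge S s = .inr ⟨s, h⟩ := dif_pos h

theorem cutEdge_eq_of_notMem {D : TraceDiagram n L V₁} {S : Set D.E}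
    {s t : EdgeEnd n V₁ D.V₂ D.Vn} (h : D.edge s ∉ S) :
    D.cutEdge S s = D.cutEdge S t ↔ D.edge s = D.edge t := by
  by_cases ht : D.edge t ∈ S
  · simp only [cutEdge, h, ht, dite_true, dite_false, reduceCtorEq, false_iff]
    exact fun hst => h (hst ▸ ht)
  · simp [cutEdge, h, ht]

theorem cut_edge_surjective [Finite V₁] {D : TraceDiagram n L V₁} (hD : Function.Surjective D.edge)
    (S : Set D.E) : Function.Surjective (D.cut S).edge := by
  rintro (⟨e, he⟩ | s)
  · obtain ⟨s | ⟨v, i⟩ | ⟨w, j⟩, rfl⟩ := hD e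
    · exact ⟨.leaf (.inl s), dif_neg he⟩
    · exact ⟨.mark v i, dif_neg he⟩
    · exact ⟨.node w j, dif_neg he⟩
  · exact ⟨.leaf (.inr s), rfl⟩

theorem disjointUnion_diagramMinor_edge_surjective {K : Type} [Fintype K] (A : K → L)
    (T : K → Finset (Fin n)) (o : K → Fin 2) :
    Function.Surjective (disjointUnion fun k => diagramMinor (A k) (T k) (o k)).edge := by
  rintro ⟨k, j | t⟩
  · exact ⟨.node ⟨k, ()⟩ j, rfl⟩
  · refine ⟨.mark ⟨k, t⟩ (1 - o k), ?_⟩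
    have : 1 - o k ≠ o k := by generalize o k = i; decide +revert
    simp [disjointUnion, diagramMinor, this]

/-- Suppose that each marking `v` is attached, through its end `o k`, to a place `pos v` at an
`n`-vertex `k`, and that the symbol and the orientation `o k` depend only on `k`. If there are no
trivial loops and no edges between two vertices of degree 1, then cutting all edges except those
at the vertices of degree 1 and those joining a marking to its `n`-vertex leaves diagram minors. -/
theorem decomposesIntoMinors_of_pos [Finite V₁] {D : TraceDiagram n L V₁}
    (hD : Function.Surjective D.edge)
    (hleaf : ∀ x y, D.edge (.leaf x) = D.edge (.leaf y) → x = y)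
    (pos : D.V₂ → D.Vn × Fin n) (hpos : Function.Injective pos)
    (A : D.Vn → L) (hA : ∀ v, D.label v = A (pos v).1) (o : D.Vn → Fin 2)
    (hedge : ∀ v, D.edge (.mark v (o (pos v).1)) = D.edge (.node (pos v).1 (pos v).2)) :
    D.DecomposesIntoMinors := by
  classical
  let S : Set D.E := {e | (∀ x, D.edge (.leaf x) ≠ e) ∧
    ∀ v, D.edge (.node (pos v).1 (pos v).2) ≠ e}
  let T : D.Vn → Finset (Fin n) := fun k => {j | ∃ v, pos v = (k, j)}
  have hT : ∀ k j, j ∈ T k ↔ ∃ v, pos v = (k, j) := fun k j => by simp [T]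
  have hTpos : ∀ v, (pos v).2 ∈ T (pos v).1 := fun v => (hT _ _).2 ⟨v, rfl⟩
  have hfin : ∀ i j : Fin 2, i ≠ j ↔ i = 1 - j := by decide
  -- the bijection between markings
  let g₀ : D.V₂ → Σ k, {j // j ∈ T k} := fun v => ⟨(pos v).1, (pos v).2, hTpos v⟩
  have hg₀ : g₀.Bijective := by
    refine ⟨fun v w hvw => hpos ?_, ?_⟩
    · exact congrArg (fun a : Σ k, {j // j ∈ T k} => (a.1, a.2.1)) hvw
    · rintro ⟨k, j, hj⟩
      obtain ⟨v, hv⟩ := (hT k j).1 hj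
      refine ⟨v, ?_⟩
      obtain rfl : (pos v).1 = k := by rw [hv]
      obtain rfl : (pos v).2 = j := by rw [hv]
      rfl
  let g := Equiv.ofBijective g₀ hg₀
  -- the last end, going outwards, on the strand from place `j` of the `n`-vertex `k`;
  -- its edge in the cut diagram leads to a vertex of degree 1
  let ext : (Σ _ : D.Vn, Fin n) → EdgeEnd n V₁ D.V₂ D.Vn := fun a =>
    if h : a.2 ∈ T a.1 then .mark (g.symm ⟨a.1, a.2, h⟩) (1 - o a.1) else .node a.1 a.2
  have hext_mark : ∀ v, ext ⟨(pos v).1, (pos v).2⟩ = .mark v (1 - o (pos v).1) := fun v => by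
    have : g.symm ⟨(pos v).1, (pos v).2, hTpos v⟩ = v := g.symm_apply_apply v
    simp only [ext, hTpos, dite_true, this]
  have hext_node : ∀ k, ∀ j ∉ T k, ext ⟨k, j⟩ = .node k j := fun k j hj => dif_neg hj
  have hext_cases : ∀ k j, (∃ v, pos v = (k, j)) ∨ j ∉ T k := fun k j => by
    rw [hT]
    exact em _
  have hext_leaf : ∀ a x, ext a ≠ .leaf x := by
    rintro ⟨k, j⟩ x
    simp only [ext]
    split_ifs <;> simp
  have hext_node_ne : ∀ a v, ext a ≠ .node (pos v).1 (pos v).2 := by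
    rintro ⟨k, j⟩ v h
    rcases hext_cases k j with ⟨w, hw⟩ | hj
    · have := hext_mark w
      rw [hw] at this
      rw [this] at h
      cases h
    · rw [hext_node k j hj] at h
      cases h
      exact hj (hTpos v)
  have hext_mark_ne : ∀ a v, ext a ≠ .mark v (o (pos v).1) := by
    rintro ⟨k, j⟩ v h
    rcases hext_cases k j with ⟨w, hw⟩ | hj
    · have := hext_mark w
      rw [hw] at this
      rw [this] at h
      injection h with h₁ h₂
      subst h₁
      rw [hw] at h₂
      exact (hfin (1 - o k) (o k)).2 rfl h₂
    · rw [hext_node k j hj] at h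
      cases h
  have hext_inj : ext.Injective := by
    rintro ⟨k, j⟩ ⟨k', j'⟩ h
    rcases hext_cases k j with ⟨w, hw⟩ | hj <;> rcases hext_cases k' j' with ⟨w', hw'⟩ | hj'
    · have h₁ := hext_mark w
      have h₂ := hext_mark w'
      rw [hw] at h₁
      rw [hw'] at h₂
      rw [h₁, h₂] at h
      injection h with h _
      subst h
      rw [hw] at hw'
      cases hw'
      rfl
    · have h₁ := hext_mark w
      rw [hw] at h₁
      rw [h₁, hext_node _ _ hj'] at h
      cases h
    · have h₂ := hext_mark w'
      rw [hw'] at h₂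
      rw [h₂, hext_node _ _ hj] at h
      cases h
    · rw [hext_node _ _ hj, hext_node _ _ hj'] at h
      cases h
      rfl
  -- an uncut edge at an outer end leads to a vertex of degree 1
  have hext_edge : ∀ a v, D.edge (.node (pos v).1 (pos v).2) ≠ D.edge (ext a) := by
    intro a v h
    refine hext_node_ne a v (eq_of_edge_eq (h.symm.trans (hedge v).symm)
      (hedge v).symm (hext_mark_ne a v) (by simp))
  have hmark_uncut : ∀ v, D.edge (.mark v (o (pos v).1)) ∉ S := fun v h => h.2 v (hedge v).symm
  have hleaf_uncut : ∀ x, D.edge (.leaf x) ∉ S := fun x h => h.1 x rfl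
  -- the edges of the cut diagram at its vertices of degree 1
  let leafEdge : V₁ ⊕ D.CutEnd S → {e : D.E // e ∉ S} ⊕ D.CutEnd S :=
    Sum.elim (fun x => D.cutEdge S (.leaf x)) .inr
  have hcut_ext : ∀ (a : Σ _ : D.Vn, Fin n) (s : V₁ ⊕ D.CutEnd S),
      leafEdge s = D.cutEdge S (ext a) ↔
        (∃ x, s = .inl x ∧ D.edge (.leaf x) = D.edge (ext a)) ∨ ∃ h, s = .inr ⟨ext a, h⟩ := by
    rintro a (x | s)
    · simpa [leafEdge] using cutEdge_eq_of_notMem (hleaf_uncut x)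
    · by_cases h : D.edge (ext a) ∈ S
      · simp [leafEdge, cutEdge_of_mem h, h]
      · simp [leafEdge, cutEdge, h]
  have hexists : ∀ a, ∃ s, leafEdge s = D.cutEdge S (ext a) := by
    intro a
    simp only [hcut_ext]
    by_cases h : D.edge (ext a) ∈ S
    · exact ⟨.inr ⟨_, h⟩, .inr ⟨h, rfl⟩⟩
    · have : ∃ x, D.edge (.leaf x) = D.edge (ext a) := by
        by_contra! hc
        exact h ⟨hc, hext_edge a⟩
      obtain ⟨x, hx⟩ := this
      exact ⟨.inl x, .inl ⟨x, rfl, hx⟩⟩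
  choose f₀ hf₀ using hexists
  have hf₀' := fun a => (hcut_ext a (f₀ a)).1 (hf₀ a)
  have hf₀_bij : f₀.Bijective := by
    constructor
    · intro a a' h
      apply hext_inj
      rcases hf₀' a with ⟨x, hx, hxa⟩ | ⟨h₁, hx⟩ <;> rcases hf₀' a' with ⟨y, hy, hya⟩ | ⟨h₂, hy⟩ <;>
        rw [h, hy] at hx
      · cases hx
        exact eq_of_edge_eq hxa.symm hya.symm (hext_leaf _ _) (hext_leaf _ _)
      · cases hx
      · cases hx
      · exact congrArg Subtype.val (Sum.inr_injective hx).symm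
    · rintro (x | ⟨s, hs⟩)
      · obtain ⟨t, hne, ht⟩ := D.ends_eq_pair (.leaf x)
        have ht' := (ht t).2 (.inr rfl)
        have : ∃ a, ext a = t := by
          rcases t with y | ⟨v, i⟩ | ⟨k, j⟩
          · exact absurd (congrArg _ (hleaf _ _ ht')) hne
          · by_cases hi : i = o (pos v).1
            · subst hi
              rw [hedge] at ht'
              rcases (ht _).1 ht' with h | h <;> cases h
            · exact ⟨_, (hext_mark v).trans (by rw [← (hfin _ _).1 hi])⟩
          · rcases hext_cases k j with ⟨v, hv⟩ | hj
            · have := hedge v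
              rw [hv, ht'] at this
              rcases (ht _).1 this with h | h <;> cases h
            · exact ⟨_, hext_node k j hj⟩
        obtain ⟨a, rfl⟩ := this
        refine ⟨a, ?_⟩
        rcases hf₀' a with ⟨y, hy, hya⟩ | ⟨h, -⟩
        · rw [hy, hleaf x y (ht'.symm.trans hya.symm)]
        · exact absurd (ht' ▸ h) (hleaf_uncut x)
      · have : ∃ a, ext a = s := by
          rcases s with y | ⟨v, i⟩ | ⟨k, j⟩
          · exact absurd hs (hleaf_uncut y)
          · by_cases hi : i = o (pos v).1
            · subst hi
              exact absurd hs (hmark_uncut v)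
            · exact ⟨_, (hext_mark v).trans (by rw [← (hfin _ _).1 hi])⟩
          · rcases hext_cases k j with ⟨v, hv⟩ | hj
            · refine absurd hs fun h => h.2 v ?_
              rw [hv]
            · exact ⟨_, hext_node k j hj⟩
        obtain ⟨a, rfl⟩ := this
        refine ⟨a, ?_⟩
        rcases hf₀' a with ⟨y, -, hya⟩ | ⟨h, hx⟩
        · exact absurd (hya ▸ hs) (hleaf_uncut y)
        · exact hx
  let f := (Equiv.ofBijective f₀ hf₀_bij).symm
  have hf : ∀ s, D.cutEdge S (ext (f s)) = leafEdge s := fun s => by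
    rw [← hf₀]
    exact congrArg leafEdge ((Equiv.ofBijective f₀ hf₀_bij).apply_symm_apply s)
  -- the map from the edges of the diagram minors to those of the cut diagram
  let edgeMap : (Σ k, Fin n ⊕ {j // j ∈ T k}) → {e : D.E // e ∉ S} ⊕ D.CutEnd S := fun e =>
    Sum.elim (fun j => D.cutEdge S (.node e.1 j))
      (fun t => D.cutEdge S (.mark (g.symm ⟨e.1, t⟩) (1 - o e.1))) e.2
  have hmap_leaf : ∀ a : Σ _ : D.Vn, Fin n,
      edgeMap ⟨a.1, if h : a.2 ∈ T a.1 then .inr ⟨a.2, h⟩ else .inl a.2⟩ =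
        D.cutEdge S (ext a) := by
    intro a
    by_cases ha : a.2 ∈ T a.1 <;> simp [edgeMap, ext, ha]
  have hmap_mark : ∀ v i, edgeMap ⟨(pos v).1, if i = o (pos v).1 then .inl (pos v).2 else
      .inr ⟨(pos v).2, hTpos v⟩⟩ = D.cutEdge S (.mark v i) := by
    intro v i
    by_cases hi : i = o (pos v).1
    · subst hi
      have := (cutEdge_eq_of_notMem (hmark_uncut v)).2 (hedge v)
      simp [edgeMap, this]
    · have hgv : g.symm ⟨(pos v).1, (pos v).2, hTpos v⟩ = v := g.symm_apply_apply v
      simp only [edgeMap, hi, if_false, Sum.elim_inr, hgv]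
      rw [← (hfin _ _).1 hi]
  refine ⟨S, fun e _ => hD e, D.Vn, inferInstance, A, T, o, nonempty_iso_of_edgeMap
    (cut_edge_surjective hD S) (disjointUnion_diagramMinor_edge_surjective A T o) f g
    (Equiv.sigmaPUnit D.Vn).symm (fun v => (hA v).symm) edgeMap ?_⟩
  rintro (s | ⟨v, i⟩ | ⟨k, j⟩)
  · refine (hmap_leaf (f s)).trans ((hf s).trans ?_)
    rcases s with x | s <;> rfl
  · exact hmap_mark v i
  · rfl

end Criterion
/-! ### Thickening of a diagram -/

section Thicken

variable {m : ℕ} {L : Type*} {V₁ : Type} (D : TraceDiagram (m + 1) L V₁)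

/-- A chosen end of the edge that contains `s`; it depends on the edge only. -/
noncomputable def firstEnd (s : EdgeEnd (m + 1) V₁ D.V₂ D.Vn) : EdgeEnd (m + 1) V₁ D.V₂ D.Vn :=
  Classical.choose (⟨s, rfl⟩ : ∃ t, D.edge t = D.edge s)

open Classical in
/-- A numbering by `0` and `1` of the two ends of each edge that is not a trivial loop. -/
noncomputable def side (s : EdgeEnd (m + 1) V₁ D.V₂ D.Vn) : Fin 2 :=
  if s = D.firstEnd s then 0 else 1

variable {D}

theorem edge_firstEnd (s : EdgeEnd (m + 1) V₁ D.V₂ D.Vn) : D.edge (D.firstEnd s) = D.edge s :=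
  Classical.choose_spec (⟨s, rfl⟩ : ∃ t, D.edge t = D.edge s)

theorem firstEnd_congr {s t : EdgeEnd (m + 1) V₁ D.V₂ D.Vn} (h : D.edge s = D.edge t) :
    D.firstEnd s = D.firstEnd t := by
  simp only [firstEnd, h]

theorem eq_of_edge_eq_of_side_eq {s t : EdgeEnd (m + 1) V₁ D.V₂ D.Vn}
    (h : D.edge s = D.edge t) (h' : D.side s = D.side t) : s = t := by
  have hst := firstEnd_congr h
  by_cases hs : s = D.firstEnd s <;> by_cases ht : t = D.firstEnd t
  · rw [hs, ht, hst]
  · simp [side, hs.symm, ht] at h'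
  · simp [side, hs, ht.symm] at h'
  · exact eq_of_edge_eq (edge_firstEnd s).symm (h.symm.trans (edge_firstEnd s).symm) hs
      (hst ▸ ht)

theorem exists_edge_side {e : D.E} (he : ¬ ∀ s, D.edge s ≠ e) (i : Fin 2) :
    ∃ s, D.edge s = e ∧ D.side s = i := by
  push Not at he
  obtain ⟨s, rfl⟩ := he
  have hf : D.firstEnd (D.firstEnd s) = D.firstEnd s := firstEnd_congr (edge_firstEnd s)
  obtain rfl | rfl : i = 0 ∨ i = 1 := by omega
  · exact ⟨D.firstEnd s, edge_firstEnd s, by simp [side, hf]⟩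
  · obtain ⟨t, hne, ht⟩ := D.ends_eq_pair (D.firstEnd s)
    have htf := (ht t).2 (.inr rfl)
    have : D.firstEnd t = D.firstEnd s := (firstEnd_congr htf).trans hf
    exact ⟨t, htf.trans (edge_firstEnd s), by simp [side, this, hne]⟩

variable (D)

/-- The edges of the thickened diagram: `m` edges that replace each edge of `D`, an edge for each
end of an edge of `D`, and an edge for each trivial loop of `D`. -/
abbrev ThickEdge : Type :=
  D.E × Fin m ⊕ (EdgeEnd (m + 1) V₁ D.V₂ D.Vn ⊕ {e : D.E // ∀ s, D.edge s ≠ e})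

open Classical in
/-- The edge of the thickened diagram at place `0` of the new `n`-vertex `(e, i)`. -/
noncomputable def outerEdge (e : D.E) (i : Fin 2) :
    EdgeEnd (m + 1) V₁ D.V₂ D.Vn ⊕ {e : D.E // ∀ s, D.edge s ≠ e} :=
  if he : ∀ s, D.edge s ≠ e then .inr ⟨e, he⟩ else .inl (exists_edge_side he i).choose

/-- The edge of the thickened diagram that contains a given end. -/
noncomputable def thickEdge :
    EdgeEnd (m + 1) V₁ D.V₂ (D.Vn ⊕ D.E × Fin 2) → D.ThickEdge
  | .leaf x => .inr (.inl (.leaf x))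
  | .mark v i => .inr (.inl (.mark v i))
  | .node (.inl w) j => .inr (.inl (.node w j))
  | .node (.inr a) j => Fin.cases (.inr (D.outerEdge a.1 a.2)) (fun k => .inl (a.1, k)) j

variable {D}

theorem outerEdge_eq_inl {e : D.E} {i : Fin 2} {s : EdgeEnd (m + 1) V₁ D.V₂ D.Vn} :
    D.outerEdge e i = .inl s ↔ D.edge s = e ∧ D.side s = i := by
  by_cases he : ∀ s, D.edge s ≠ e
  · simp [outerEdge, he]
  · have h := (exists_edge_side he i).choose_spec
    simp only [outerEdge, he, dite_false, Sum.inl.injEq]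
    constructor
    · rintro rfl
      exact h
    · rintro ⟨h₁, h₂⟩
      exact eq_of_edge_eq_of_side_eq (h.1.trans h₁.symm) (h.2.trans h₂.symm)

theorem outerEdge_eq_inr {e : D.E} {i : Fin 2} {e' : {e : D.E // ∀ s, D.edge s ≠ e}} :
    D.outerEdge e i = .inr e' ↔ e = e' := by
  by_cases he : ∀ s, D.edge s ≠ e
  · simp [outerEdge, he, Subtype.ext_iff]
  · simp only [outerEdge, he, dite_false, reduceCtorEq, false_iff]
    rintro rfl
    exact he e'.2

/-- The ends in the thickened diagram: the ends in `D`, and the places `0` and `k + 1` at the new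
`n`-vertices. -/
theorem thickEdge_cases (s : EdgeEnd (m + 1) V₁ D.V₂ (D.Vn ⊕ D.E × Fin 2)) :
    (∃ t : EdgeEnd (m + 1) V₁ D.V₂ D.Vn,
      s = t.map id id Sum.inl ∧ D.thickEdge s = .inr (.inl t)) ∨
    (∃ e i, s = .node (.inr (e, i)) 0 ∧ D.thickEdge s = .inr (D.outerEdge e i)) ∨
    ∃ e i k, s = .node (.inr (e, i)) (Fin.succ k) ∧ D.thickEdge s = .inl (e, k) := by
  rcases s with x | ⟨v, i⟩ | ⟨w | ⟨e, i⟩, j⟩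
  · exact .inl ⟨.leaf x, rfl, rfl⟩
  · exact .inl ⟨.mark v i, rfl, rfl⟩
  · exact .inl ⟨.node w j, rfl, rfl⟩
  · induction j using Fin.cases with
    | zero => exact .inr (.inl ⟨e, i, rfl, rfl⟩)
    | succ k => exact .inr (.inr ⟨e, i, k, rfl, rfl⟩)

theorem map_inl_ne_node_inr (t : EdgeEnd (m + 1) V₁ D.V₂ D.Vn) (a : D.E × Fin 2)
    (j : Fin (m + 1)) : t.map id id Sum.inl ≠ .node (.inr a) j := by
  cases t <;> simp [EdgeEnd.map]

theorem thickEdge_ends (e : D.ThickEdge) : {s | D.thickEdge s = e}.encard = 2 := by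
  have hinj := EdgeEnd.map_injective (n := m + 1) (Function.injective_id (α := V₁))
    (Function.injective_id (α := D.V₂)) (Sum.inl_injective (α := D.Vn) (β := D.E × Fin 2))
  have hfin : ∀ i : Fin 2, i = 0 ∨ i = 1 := by decide
  rcases e with ⟨e, k⟩ | s | e
  · rw [← Set.encard_pair (show (.node (.inr (e, 0)) k.succ :
      EdgeEnd (m + 1) V₁ D.V₂ (D.Vn ⊕ D.E × Fin 2)) ≠ .node (.inr (e, 1)) k.succ by simp)]
    congr 1
    ext s
    rcases D.thickEdge_cases s with ⟨t, rfl, h⟩ | ⟨e', i, rfl, h⟩ | ⟨e', i, k', rfl, h⟩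
    · simp [h, map_inl_ne_node_inr]
    · simp [h, (Fin.succ_ne_zero _).symm]
    · have := hfin i
      simp only [Set.mem_ofPred_eq, h, Sum.inl.injEq, Prod.mk.injEq, Set.mem_insert_iff,
        EdgeEnd.node.injEq, Sum.inr.injEq, Fin.succ_inj, Set.mem_singleton_iff]
      tauto
  · rw [← Set.encard_pair (D.map_inl_ne_node_inr s (D.edge s, D.side s) 0)]
    congr 1
    ext s'
    rcases D.thickEdge_cases s' with ⟨t, rfl, h⟩ | ⟨e', i, rfl, h⟩ | ⟨e', i, k', rfl, h⟩
    · simp [h, map_inl_ne_node_inr, hinj.eq_iff]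
    · simp [h, outerEdge_eq_inl, (map_inl_ne_node_inr s _ _).symm, eq_comm]
    · simp [h, (map_inl_ne_node_inr s _ _).symm]
  · rw [← Set.encard_pair (show (.node (.inr (e.1, 0)) 0 :
      EdgeEnd (m + 1) V₁ D.V₂ (D.Vn ⊕ D.E × Fin 2)) ≠ .node (.inr (e.1, 1)) 0 by simp)]
    congr 1
    ext s
    rcases D.thickEdge_cases s with ⟨t, rfl, h⟩ | ⟨e', i, rfl, h⟩ | ⟨e', i, k', rfl, h⟩
    · simp [h, map_inl_ne_node_inr]
    · have := hfin i
      simp only [Set.mem_ofPred_eq, h, Sum.inr.injEq, outerEdge_eq_inr, Set.mem_insert_iff,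
        EdgeEnd.node.injEq, Prod.mk.injEq, Set.mem_singleton_iff]
      tauto
    · simp [h]

variable (D)

/-- The diagram in which two new `n`-vertices `(e, 0)` and `(e, 1)`, joined by `n - 1` parallel
edges, are inserted into each edge `e`. In particular a trivial loop becomes a pair of `n`-vertices
joined by `n` edges. The edges at `(e, 0)` and `(e, 1)` have the same ordering, with the remaining
half of `e` at place `0`. -/
noncomputable def thicken [Finite V₁] : TraceDiagram (m + 1) L V₁ where
  V₂ := D.V₂
  Vn := D.Vn ⊕ D.E × Fin 2
  E := D.ThickEdge
  fintypeE := Fintype.ofFinite _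
  edge := D.thickEdge
  label := D.label
  ends_eq e := .inr (D.thickEdge_ends e)

theorem thickEdge_surjective : Function.Surjective D.thickEdge := fun e => by
  have : {s | D.thickEdge s = e}.Nonempty := by
    rw [← Set.encard_ne_zero, D.thickEdge_ends e]
    exact two_ne_zero
  exact this

/-- Each marking of a thickened diagram has its incoming edge at a new `n`-vertex of its own. -/
theorem decomposesIntoMinors_thicken [Finite V₁] [Nonempty L] :
    D.thicken.DecomposesIntoMinors := by
  let pos : D.V₂ → (D.Vn ⊕ D.E × Fin 2) × Fin (m + 1) := fun v =>
    (.inr (D.edge (.mark v 0), D.side (.mark v 0)), 0)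
  have hpos : Function.Injective fun v => (pos v).1 := by
    intro v w h
    simp only [pos, Sum.inr.injEq, Prod.mk.injEq] at h
    have := eq_of_edge_eq_of_side_eq h.1 h.2
    injection this
  -- each new `n`-vertex carries at most one marking, whose symbol can be assigned to it
  refine decomposesIntoMinors_of_pos (D := D.thicken) D.thickEdge_surjective (fun x y h => ?_) pos
    (fun v w h => hpos (congrArg Prod.fst h))
    (Function.extend (fun v => (pos v).1) D.label fun _ => Classical.arbitrary L)
    (fun v => (hpos.extend_apply _ _ v).symm) (fun _ => 0) fun v => ?_
  · change (.inr (.inl (.leaf x)) : D.ThickEdge) = .inr (.inl (.leaf y)) at h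
    simpa using h
  · exact congrArg Sum.inr (outerEdge_eq_inl.2 ⟨rfl, rfl⟩).symm

/-! ### The weight of a thickened diagram -/

/-- The coloring of the thickened diagram that extends `κ` and induces at both `n`-vertices `(e, i)`
the permutation with value `κ e` at `0` and remaining part `ρ e`. -/
def thickColoring (κ : D.E → Fin (m + 1)) (ρ : D.E → Equiv.Perm (Fin m)) :
    D.ThickEdge → Fin (m + 1)
  | .inl a => Equiv.Perm.decomposeFin.symm (κ a.1, ρ a.1) a.2.succ
  | .inr (.inl s) => κ (D.edge s)
  | .inr (.inr e) => κ e

variable {D}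

theorem thickColoring_outerEdge (κ : D.E → Fin (m + 1)) (ρ : D.E → Equiv.Perm (Fin m)) (e : D.E)
    (i : Fin 2) : D.thickColoring κ ρ (.inr (D.outerEdge e i)) = κ e := by
  rcases h : D.outerEdge e i with s | e'
  · rw [outerEdge_eq_inl] at h
    simp [thickColoring, h.1]
  · rw [outerEdge_eq_inr] at h
    simp [thickColoring, h]

theorem thickColoring_node (κ : D.E → Fin (m + 1)) (ρ : D.E → Equiv.Perm (Fin m))
    (a : D.E × Fin 2) (j : Fin (m + 1)) :
    D.thickColoring κ ρ (D.thickEdge (.node (.inr a) j)) =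
      Equiv.Perm.decomposeFin.symm (κ a.1, ρ a.1) j := by
  induction j using Fin.cases with
  | zero => rw [Equiv.Perm.decomposeFin_symm_apply_zero]; exact thickColoring_outerEdge κ ρ a.1 a.2
  | succ k => rfl

theorem isProper_thickColoring [Finite V₁] {κ : D.E → Fin (m + 1)} (hκ : D.IsProper κ)
    (ρ : D.E → Equiv.Perm (Fin m)) : D.thicken.IsProper (D.thickColoring κ ρ) := by
  rintro (w | a)
  · exact hκ w
  · have := (Equiv.Perm.decomposeFin.symm (κ a.1, ρ a.1)).injective
    rwa [← funext (thickColoring_node κ ρ a)] at this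

/-- The signs at the two new `n`-vertices on an edge cancel. -/
theorem signature_thickColoring [Finite V₁] {κ : D.E → Fin (m + 1)} (hκ : D.IsProper κ)
    (ρ : D.E → Equiv.Perm (Fin m)) :
    D.thicken.signature (D.thickColoring κ ρ) (isProper_thickColoring hκ ρ) =
      D.signature κ hκ := by
  have hnode : ∀ a, D.thicken.perm _ (isProper_thickColoring hκ ρ) (.inr a) =
      Equiv.Perm.decomposeFin.symm (κ a.1, ρ a.1) := fun a =>
    Equiv.ext (thickColoring_node κ ρ a)
  have hold : ∀ w, D.thicken.perm _ (isProper_thickColoring hκ ρ) (.inl w) = D.perm κ hκ w :=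
    fun w => rfl
  refine (Fintype.prod_sum_type (α₁ := D.Vn) (α₂ := D.E × Fin 2) _).trans ?_
  simp only [hnode, hold, Fintype.prod_prod_type, Fin.prod_univ_two, Int.units_mul_self,
    Finset.prod_const_one, mul_one, signature]

/-- A permutation is determined by its values away from `0`. -/
theorem perm_eq_of_succ {σ τ : Equiv.Perm (Fin (m + 1))} (h : ∀ k : Fin m, σ k.succ = τ k.succ) :
    σ = τ := by
  have h0 : σ 0 = τ 0 := by
    obtain ⟨j, hj⟩ := τ.surjective (σ 0)
    induction j using Fin.cases with
    | zero => exact hj.symm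
    | succ k =>
      rw [← h] at hj
      exact absurd (σ.injective hj) (Fin.succ_ne_zero k)
  ext j
  induction j using Fin.cases with
  | zero => rw [h0]
  | succ k => rw [h]

/-- The proper colorings of the thickened diagram are the `thickColoring κ ρ`, for `κ` a proper
coloring of `D` and `ρ` a choice of a permutation of `n - 1` colors on each edge. -/
theorem exists_thickColoring_eq [Finite V₁] {κ' : D.ThickEdge → Fin (m + 1)}
    (hκ' : D.thicken.IsProper κ') : ∃ κ ρ, D.IsProper κ ∧ D.thickColoring κ ρ = κ' := by
  let σ : D.E × Fin 2 → Equiv.Perm (Fin (m + 1)) := fun a => D.thicken.perm κ' hκ' (.inr a)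
  have hzero : ∀ e i, σ (e, i) 0 = κ' (.inr (D.outerEdge e i)) := fun e i => rfl
  have hsucc : ∀ e i k, σ (e, i) (Fin.succ k) = κ' (.inl (e, k)) := fun e i k => rfl
  have hσ : ∀ e i, σ (e, i) = σ (e, 0) := fun e i => perm_eq_of_succ fun k => rfl
  -- the two permutations on an edge agree away from `0`, hence also at `0`, so the two remaining
  -- halves of the edge have the same color
  have hold : ∀ s, σ (D.edge s, 0) 0 = κ' (.inr (.inl s)) := fun s => by
    rw [← hσ _ (D.side s), hzero, outerEdge_eq_inl.2 ⟨rfl, rfl⟩]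
  have hdec : ∀ τ : Equiv.Perm (Fin (m + 1)),
      Equiv.Perm.decomposeFin.symm (τ 0, (Equiv.Perm.decomposeFin τ).2) = τ := fun τ => by
    obtain ⟨⟨p, ρ⟩, rfl⟩ := Equiv.Perm.decomposeFin.symm.surjective τ
    simp
  refine ⟨fun e => σ (e, 0) 0, fun e => (Equiv.Perm.decomposeFin (σ (e, 0))).2, fun w => ?_, ?_⟩
  · simp only [hold]
    exact hκ' (.inl w)
  · funext a
    rcases a with ⟨e, k⟩ | s | e
    · simp only [thickColoring, hdec, hsucc]
    · exact hold s
    · exact congrArg (fun x => κ' (.inr x)) (outerEdge_eq_inr (e' := e).2 rfl)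

/-- Each proper coloring of `D` extends to the thickened diagram in `(n - 1)!` ways for each edge,
and all extensions have the same signature and coefficient. -/
theorem weight_thicken {F V : Type*} [Field F] [AddCommGroup V] [Module F V] [Finite V₁]
    (b : Module.Basis (Fin (m + 1)) F V) (M : L → V →ₗ[F] V) (γ : V₁ → Fin (m + 1)) :
    D.thicken.weight b M γ = (m.factorial : F) ^ Fintype.card D.E * D.weight b M γ := by
  classical
  have hsum : ∀ {X : Type} [Fintype X] (f : X → F),
      (m.factorial : F) ^ Fintype.card D.E * ∑ κ, f κ =
        ∑ x : X × (D.E → Equiv.Perm (Fin m)), f x.1 := by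
    intro X _ f
    rw [Fintype.sum_prod_type, Finset.mul_sum]
    simp [Fintype.card_perm]
  rw [weight, weight, hsum]
  symm
  refine @Fintype.sum_bijective _ _ _ (_) (_) (_) (fun x => ⟨D.thickColoring x.1.1 x.2,
    isProper_thickColoring x.1.2.1 x.2, x.1.2.2⟩) ⟨?_, ?_⟩ _ _ ?_
  · rintro ⟨⟨κ, hκ⟩, ρ⟩ ⟨⟨κ₁, hκ₁⟩, ρ₁⟩ h
    have h' : D.thickColoring κ ρ = D.thickColoring κ₁ ρ₁ := congrArg Subtype.val h
    have key : ∀ e, (κ e, ρ e) = (κ₁ e, ρ₁ e) := fun e => by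
      apply Equiv.Perm.decomposeFin.symm.injective
      ext j
      rw [← thickColoring_node κ ρ (e, 0), h', thickColoring_node]
    obtain rfl : κ = κ₁ := funext fun e => congrArg Prod.fst (key e)
    obtain rfl : ρ = ρ₁ := funext fun e => congrArg Prod.snd (key e)
    rfl
  · rintro ⟨κ', hκ', hγ⟩
    obtain ⟨κ, ρ, hκ, rfl⟩ := exists_thickColoring_eq hκ'
    exact ⟨⟨⟨κ, hκ, hγ⟩, ρ⟩, rfl⟩
  · rintro ⟨⟨κ, hκ, hγ⟩, ρ⟩
    exact congrArg (fun ε : ℤˣ => ((ε : ℤ) : F) * D.coeff b M κ)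
      (signature_thickColoring hκ ρ).symm

end Thicken

theorem function_eq_smul {F V L : Type*} [Field F] [AddCommGroup V] [Module F V] {n : ℕ}
    {V₁ : Type} (b : Module.Basis (Fin n) F V) (M : L → V →ₗ[F] V) {D D' : TraceDiagram n L V₁}
    {C : F} (h : ∀ γ, D.weight b M γ = C * D'.weight b M γ) {p q : ℕ} (φ : Fin p ⊕ Fin q ≃ V₁) :
    D.function b M φ = C • D'.function b M φ := by
  rw [function, function, ← map_smul]
  congr 1
  funext α
  simp only [h, mul_smul, Finset.smul_sum, Pi.smul_apply]

end TraceDiagram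

theorem mainTheorem3 {F V L : Type*} [Field F] [AddCommGroup V] [Module F V] [Nonempty L]
    (n : ℕ) (hn : 2 ≤ n) (hF : ((n - 1).factorial : F) ≠ 0) (b : Module.Basis (Fin n) F V)
    {V₁ : Type} [Finite V₁] (D : TraceDiagram n L V₁) (hD : D.MarkingsAdjacentToNodes) :
    (∃ (C : F) (D' : TraceDiagram n L V₁), C ≠ 0 ∧ D'.DecomposesIntoMinors ∧
      ∀ (M : L → V →ₗ[F] V) (p q : ℕ) (φ : Fin p ⊕ Fin q ≃ V₁),
        D.function b M φ = C • D'.function b M φ) ∧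
    ∀ (A : L) (T : Finset (Fin n)) (o : Fin 2) (γ : Fin n → Fin n),
      (Set.InjOn γ T ∧ Set.InjOn γ (Tᶜ : Finset (Fin n)) →
        ∃ (h : (T.image γ).card = (Tᶜ.image γ)ᶜ.card) (ε : ℤˣ), ∀ M : L → V →ₗ[F] V,
          (TraceDiagram.diagramMinor A T o).weight b M γ =
            ((ε : ℤ) : F) *
              if o = 0 then matrixMinor (LinearMap.toMatrix b b (M A)) (T.image γ) (Tᶜ.image γ)ᶜ h
              else matrixMinor (LinearMap.toMatrix b b (M A)) (Tᶜ.image γ)ᶜ (T.image γ) h.symm) ∧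
      (¬ (Set.InjOn γ T ∧ Set.InjOn γ (Tᶜ : Finset (Fin n))) →
        ∀ M : L → V →ₗ[F] V, (TraceDiagram.diagramMinor A T o).weight b M γ = 0) := by
  refine ⟨?_, fun A T o γ => ⟨fun ⟨h₁, h₂⟩ => ?_, fun h M => ?_⟩⟩
  · obtain ⟨m, rfl⟩ : ∃ m, n = m + 1 := ⟨n - 1, by omega⟩
    rw [Nat.add_sub_cancel] at hF
    have hC : (m.factorial : F) ^ Fintype.card D.E ≠ 0 := pow_ne_zero _ hF
    refine ⟨((m.factorial : F) ^ Fintype.card D.E)⁻¹, D.thicken, inv_ne_zero hC,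
      D.decomposesIntoMinors_thicken, fun M p q φ => ?_⟩
    refine TraceDiagram.function_eq_smul b M (fun γ => ?_) φ
    rw [TraceDiagram.weight_thicken, inv_mul_cancel_left₀ hC]
  · have hcard := card_image_eq_card_compl_image h₁ h₂
    obtain ⟨ε, hε⟩ := exists_det_rowSelection_eq (F := F) h₁ h₂ hcard
    refine ⟨hcard, ε, fun M => ?_⟩
    rw [TraceDiagram.weight_diagramMinor, hε]
    split_ifs with ho
    · rfl
    · rw [matrixMinor_transpose]
  · rw [TraceDiagram.weight_diagramMinor, det_rowSelection_eq_zero _ h]
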